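/- Let $s\ge 0$, $n=2s+1$, and let $N$ be a positive integer coprime to $n+1$. A twisted $N$-gon in $\mathbb{RP}^n$ is a sequence $x=(x_k)_{k\in\mathbb Z}$ of points with $x_{k+N}=M\cdot x_k$ for all $k$, for some $M\in \mathrm{SL}(n+1,\mathbb R)$ (a chosen representative of the monodromy in $\mathrm{PSL}(n+1,\mathbb R)$). A normalized lift of $x$ is a sequence of vectors $V_k\in\mathbb R^{n+1}$ representing $x_k$ with $\det(V_k,V_{k+1},\dots,V_{k+n})=1$ and $V_{k+N}=MV_k$ for all $k$. The projective invariants $a=(a_k^i)$, $k\in\mathbb Z$, $1\le i\le n$, of $x$ (relative to $M$) are the coefficients in $$V_{k+n+1}=a_k^nV_{k+n}+a_k^{n-1}V_{k+n-1}+\dots+a_k^1V_{k+1}+(-1)^nV_k .$$ Let $P_k$ be the projective span of the $n$ vertices $x_{k-2s},x_{k-2s+2},\dots,x_{k+2s-2},x_{k+2s}$. Call $x$ generic if, for every $k$, $P_k$ is a hyperplane and $P_{k-s}\cap P_{k-s+1}\cap\dots\cap P_{k+s}$ is a single point. The generalized pentagram map $T$ sends a generic polygon $x$ to the polygon with vertices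 $$T(x)_k=P_{k-s}\cap P_{k-s+1}\cap\dots\cap P_{k+s}.$$ Write $T(a)=b$ if some generic twisted $N$-gon $x$ has invariants $a$ relative to some representative $M$ of its monodromy, and $T(x)$ has invariants $b$ relative to the same $M$. Then: 1. $T$ is a well-defined partial map on the invariants: if $T(a)=b$, then every twisted $N$-gon $x$ which has invariants $a$, relative to some representative $M$ of its monodromy, is generic, and $b$ is the one and only family of invariants of $T(x)$ relative to $M$. 2. $T$ is invariant under the scaling $$a_k^{i}\mapsto t\,a_k^{i}\ \ (i \text{ odd}),\qquad a_k^{i}\mapsto a_k^{i}\ \ (i\text{ even}).$$ That is, for every real $t\ne0$, writing $t\cdot a$ for the scaled invariants, $T(a)=b$ if and only if $T(t\cdot a)=t\cdot b$. In particular the domain of $T$ is preserved and $T(t\cdot a)=t\cdot T(a)$ for all $a$ in it. -/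

import Mathlib

open scoped LinearAlgebra.Projectivization

namespace Pentagram

/-- The vector space `ℝ^{n+1}`, where `n = 2s+1`. -/
abbrev Vec (s : ℕ) : Type := Fin (2 * s + 2) → ℝ

/-- The real projective space `RP^n`, where `n = 2s+1`. -/
abbrev RP (s : ℕ) : Type := ℙ ℝ (Vec s)

/-- The group `SL(n+1, ℝ)`, where `n = 2s+1`; it acts on `RP s` through `PSL(n+1, ℝ)`. -/
abbrev SLn (s : ℕ) : Type := Matrix.SpecialLinearGroup (Fin (2 * s + 2)) ℝ

/-- The polygon `x` is a twisted `N`-gon in `RP^n`; its monodromy is the class of `M`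
in `PSL(n+1, ℝ)`. -/
def IsTwisted {s : ℕ} (N : ℕ) (M : SLn s) (x : ℤ → RP s) : Prop :=
  ∀ k : ℤ, x (k + N) = M • x k

/-- The linear subspace of `ℝ^{n+1}` over the projective span `P_k` of the `n` vertices
`x_{k-2s}, x_{k-2s+2}, …, x_{k+2s}`. -/
noncomputable def hyperplane {s : ℕ} (x : ℤ → RP s) (k : ℤ) : Submodule ℝ (Vec s) :=
  ⨆ j : Fin (2 * s + 1), (x (k - 2 * s + 2 * (j : ℤ))).submodule

/-- The linear subspace over the intersection `P_{k-s} ∩ P_{k-s+1} ∩ ⋯ ∩ P_{k+s}`. -/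
noncomputable def hyperplaneInter {s : ℕ} (x : ℤ → RP s) (k : ℤ) : Submodule ℝ (Vec s) :=
  ⨅ j : Fin (2 * s + 1), hyperplane x (k - s + (j : ℤ))

/-- The genericity under which the generalized pentagram map is defined: for all `k` the chosen
`n` vertices determine a hyperplane `P_k`, and `n` consecutive ones meet in exactly one point. -/
structure IsGeneric {s : ℕ} (x : ℤ → RP s) : Prop where
  finrank_hyperplane : ∀ k : ℤ, Module.finrank ℝ (hyperplane x k) = 2 * s + 1
  finrank_inter : ∀ k : ℤ, Module.finrank ℝ (hyperplaneInter x k) = 1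

/-- The generalized pentagram map on polygons in `RP^{2s+1}`:
`T(x)_k = P_{k-s} ∩ P_{k-s+1} ∩ ⋯ ∩ P_{k+s}`. -/
noncomputable def pentagramMap {s : ℕ} (x : ℤ → RP s) (hx : IsGeneric x) : ℤ → RP s :=
  fun k => Projectivization.mk'' (hyperplaneInter x k) (hx.finrank_inter k)

/-- The matrix with columns `V_k, V_{k+1}, …, V_{k+n}` (the projective moving frame). -/
def frame {s : ℕ} (V : ℤ → Vec s) (k : ℤ) : Matrix (Fin (2 * s + 2)) (Fin (2 * s + 2)) ℝ :=
  Matrix.of fun i j => V (k + (j : ℤ)) i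

/-- `V` is a normalized lift of the polygon `x` with lifted monodromy `g`: the vector `V_k`
represents `x_k`, one has `det(V_k, …, V_{k+n}) = 1`, and `V_{k+N} = g V_k`, for all `k`. -/
structure IsNormalizedLift {s : ℕ} (N : ℕ) (g : SLn s) (x : ℤ → RP s)
    (V : ℤ → Vec s) : Prop where
  represents : ∀ k : ℤ, ∃ h : V k ≠ 0, Projectivization.mk ℝ (V k) h = x k
  det_eq_one : ∀ k : ℤ, (frame V k).det = 1
  monodromy : ∀ k : ℤ, V (k + N) = g • V k

/-- The coordinates of the moduli space of polygons: `a k j` is `a_k^{j+1}`, for `k ∈ ℤ` and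
`j = 0, …, n-1`, where `n = 2s+1`. -/
abbrev Coords (s : ℕ) : Type := ℤ → Fin (2 * s + 1) → ℝ

/-- `a` is the family of projective invariants of the twisted `N`-gon `x`, for the choice `g` of
the lifted monodromy: some normalized lift `V` of `x` satisfies
`V_{k+n+1} = a_k^n V_{k+n} + ⋯ + a_k^1 V_{k+1} + (-1)^n V_k` for all `k`. -/
def HasInvariants {s : ℕ} (N : ℕ) (g : SLn s) (x : ℤ → RP s) (a : Coords s) : Prop :=
  ∃ V : ℤ → Vec s, IsNormalizedLift N g x V ∧
    ∀ k : ℤ, V (k + (2 * s + 2)) =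
      (∑ j : Fin (2 * s + 1), a k j • V (k + ((j : ℤ) + 1))) + (-1 : ℝ) ^ (2 * s + 1) • V k

/-- The pentagram map written on the projective invariants, as a relation (the graph of a partial
map): some generic twisted `N`-gon `x` has invariants `a`, and its image `T(x)`, which has the same
monodromy, has invariants `b`, for the same choice `M` of the monodromy in `SL(n+1, ℝ)`. -/
def InducedMap (s N : ℕ) (a b : Coords s) : Prop :=
  ∃ (M : SLn s) (x : ℤ → RP s) (hx : IsGeneric x), IsTwisted N M x ∧
    HasInvariants N M x a ∧ HasInvariants N M (pentagramMap x hx) b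

/-- The scaling `a_k^i ↦ t a_k^i` for `i` odd, `a_k^i ↦ a_k^i` for `i` even. -/
noncomputable def scaling {s : ℕ} (t : ℝ) (a : Coords s) : Coords s :=
  fun k j => if Odd ((j : ℕ) + 1) then t * a k j else a k j

end Pentagram

namespace Pentagram

/-! ### Spans of indexed families and the subspaces over `P_k`. -/

open Finsupp (linearCombination supported single)

/-! Since `n` is odd, the recurrence separates by parity of index into `E_k(V) = O_k(V)`: `O_k`
(`oddPart`) carries the odd coefficients, `E_k` (`evenPart`) the even ones and the two end terms.
Scaling the coefficients by `t` changes this to `E_k(V) = t O_k(V)`, with the same formal operators.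
The vector `U_k = O_{k-s-1}(V)` thus lies in spans of vertices of both parities, hence in all the
hyperplanes that define `T(x)_k`.

A lift of `T(x)` has the form `c_k U_k`. That it satisfies the recurrence for `b` amounts to the
formal identity `E^b ∘ c O^a = O^b ∘ c E^a`, which does not contain `t`. It is extracted from one
polygon, where the vertices involved are linearly independent (`exists_intertwines`), and then
applied to every polygon with invariants `t·a` (`hasInvariants_pentagramMap_of_intertwines`). The
normalization of `c` is also free of `t`: the frame determinant of `U` is a Sylvester-type
determinant of `O` and `E` (`det_frame_oddPart`), and it governs genericity too.

Coprimality makes normalized lifts unique up to a constant (`hasInvariants_unique`). Companion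
matrices supply a polygon with the scaled invariants (`exists_recurrence`). The case `s = 0` is
separate: there `T` is the identity. -/

/-- The integers of `[l, h]` with the parity of `l`. -/
def stepSet (l h : ℤ) : Set ℤ := {i | l ≤ i ∧ i ≤ h ∧ (i - l) % 2 = 0}

theorem stepSet_subset {l h l' h' : ℤ} (hl : l' ≤ l) (hh : h ≤ h') (hp : (l - l') % 2 = 0) :
    stepSet l h ⊆ stepSet l' h' := by
  rintro i ⟨h1, h2, h3⟩
  exact ⟨by lia, by lia, by lia⟩

theorem range_step (l : ℤ) (m : ℕ) :
    Set.range (fun j : Fin (m + 1) => l + 2 * (j : ℤ)) = stepSet l (l + 2 * m) := by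
  ext i
  constructor
  · rintro ⟨j, rfl⟩
    have := j.2
    exact ⟨by lia, by lia, by simp⟩
  · rintro ⟨h1, h2, h3⟩
    refine ⟨⟨((i - l) / 2).toNat, by lia⟩, ?_⟩
    simp only
    lia

theorem range_window (l : ℤ) (m : ℕ) :
    Set.range (fun j : Fin (m + 1) => l + (j : ℤ)) = Set.Icc l (l + m) := by
  ext i
  constructor
  · rintro ⟨j, rfl⟩
    have := j.2
    exact ⟨by lia, by lia⟩
  · rintro ⟨h1, h2⟩
    refine ⟨⟨(i - l).toNat, by lia⟩, ?_⟩
    simp only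
    lia

theorem linearCombination_mem_span {M : Type*} [AddCommGroup M] [Module ℝ M] (V : ℤ → M)
    {S : Set ℤ} {f : ℤ →₀ ℝ} (hf : f ∈ supported ℝ ℝ S) :
    linearCombination ℝ V f ∈ Submodule.span ℝ (V '' S) :=
  (Finsupp.mem_span_image_iff_linearCombination ℝ).2 ⟨f, hf, rfl⟩

theorem span_image_inf {M : Type*} [AddCommGroup M] [Module ℝ M] {V : ℤ → M} {S A B : Set ℤ}
    (h : LinearIndepOn ℝ V S) (hA : A ⊆ S) (hB : B ⊆ S) {v : M}
    (hvA : v ∈ Submodule.span ℝ (V '' A)) (hvB : v ∈ Submodule.span ℝ (V '' B)) :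
    v ∈ Submodule.span ℝ (V '' (A ∩ B)) := by
  obtain ⟨f, hf, rfl⟩ := (Finsupp.mem_span_image_iff_linearCombination ℝ).1 hvA
  obtain ⟨g, hg, hfg⟩ := (Finsupp.mem_span_image_iff_linearCombination ℝ).1 hvB
  have : f - g = 0 := linearIndepOn_iff.1 h _
    (sub_mem (Finsupp.supported_mono hA hf) (Finsupp.supported_mono hB hg)) (by simp [hfg])
  obtain rfl := sub_eq_zero.1 this
  refine linearCombination_mem_span V ?_
  rw [Finsupp.supported_inter]
  exact ⟨hf, hg⟩

theorem hyperplane_eq_span {s : ℕ} {x : ℤ → RP s} {V : ℤ → Vec s}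
    (hV : ∀ k, ∃ h : V k ≠ 0, Projectivization.mk ℝ (V k) h = x k) (k : ℤ) :
    hyperplane x k = Submodule.span ℝ (V '' stepSet (k - 2 * s) (k + 2 * s)) := by
  have h2 : k + 2 * (s : ℤ) = (k - 2 * s) + 2 * ((2 * s : ℕ) : ℤ) := by push_cast; ring
  rw [h2, ← range_step, ← Set.range_comp, Submodule.span_range_eq_iSup]
  refine iSup_congr fun j => ?_
  obtain ⟨h, e⟩ := hV (k - 2 * s + 2 * (j : ℤ))
  rw [← e, Projectivization.submodule_mk]
  rfl

theorem finrank_hyperplane_le {s : ℕ} {x : ℤ → RP s} {V : ℤ → Vec s}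
    (hV : ∀ k, ∃ h : V k ≠ 0, Projectivization.mk ℝ (V k) h = x k) (k : ℤ) :
    Module.finrank ℝ (hyperplane x k) ≤ 2 * s + 1 := by
  have h2 : k + 2 * (s : ℤ) = (k - 2 * s) + 2 * ((2 * s : ℕ) : ℤ) := by push_cast; ring
  rw [hyperplane_eq_span hV, h2, ← range_step, ← Set.range_comp]
  exact (finrank_range_le_card _).trans (by simp)

theorem mem_hyperplane_of_mem_inter {s : ℕ} {x : ℤ → RP s} {k j : ℤ} {v : Vec s}
    (hv : v ∈ hyperplaneInter x k) (h1 : k - s ≤ j) (h2 : j ≤ k + s) : v ∈ hyperplane x j := by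
  have := (Submodule.mem_iInf _).1 hv ⟨(j - (k - s)).toNat, by lia⟩
  have e : k - (s : ℤ) + (((j - (k - s)).toNat : ℕ) : ℤ) = j := by lia
  simp only [e] at this
  exact this

theorem mem_inter_iff {s : ℕ} {x : ℤ → RP s} {k : ℤ} {v : Vec s} :
    v ∈ hyperplaneInter x k ↔ ∀ j, k - s ≤ j → j ≤ k + s → v ∈ hyperplane x j := by
  refine ⟨fun h j h1 h2 => mem_hyperplane_of_mem_inter h h1 h2, fun h => ?_⟩
  refine (Submodule.mem_iInf _).2 fun j => h _ (by lia) ?_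
  have := j.2
  lia

theorem linearIndepOn_window {s : ℕ} {Y : ℤ → Vec s} {k : ℤ} (h : (frame Y k).det ≠ 0) :
    LinearIndepOn ℝ Y (Set.Icc k (k + (2 * s + 1 : ℕ))) := by
  rw [← range_window, linearIndepOn_range_iff (fun a b hab => by
    simp only [add_right_inj, Nat.cast_inj] at hab; exact Fin.ext hab)]
  have := Matrix.linearIndependent_cols_iff_isUnit.2
    ((Matrix.isUnit_iff_isUnit_det _).2 (isUnit_iff_ne_zero.2 h))
  exact this

/-! ### Genericity from points of the intersections whose frames are nondegenerate. -/

section Transversal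

variable {s : ℕ} {x : ℤ → RP s} {V Y : ℤ → Vec s}

theorem span_window_le_hyperplane (hY : ∀ k, Y k ∈ hyperplaneInter x k) (k : ℤ) :
    Submodule.span ℝ (Y '' Set.Icc (k - s) (k + s)) ≤ hyperplane x k := by
  rw [Submodule.span_le]
  rintro _ ⟨j, ⟨h1, h2⟩, rfl⟩
  exact mem_hyperplane_of_mem_inter (hY j) (by lia) (by lia)

theorem finrank_span_window (hd : ∀ k, (frame Y k).det ≠ 0) (k : ℤ) :
    Module.finrank ℝ (Submodule.span ℝ (Y '' Set.Icc (k - s) (k + s))) = 2 * s + 1 := by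
  have h2 : k + (s : ℤ) = (k - s) + ((2 * s : ℕ) : ℤ) := by push_cast; ring
  have hi := (linearIndepOn_window (hd (k - s))).mono
    (t := Set.Icc (k - s) (k + s)) (Set.Icc_subset_Icc le_rfl (by lia))
  rw [h2, ← range_window, linearIndepOn_range_iff (fun a b hab => by
    simp only [add_right_inj, Nat.cast_inj] at hab; exact Fin.ext hab)] at hi
  rw [h2, ← range_window, ← Set.range_comp, finrank_span_eq_card hi]
  simp

theorem hyperplane_eq_span_window
    (hV : ∀ k, ∃ h : V k ≠ 0, Projectivization.mk ℝ (V k) h = x k)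
    (hY : ∀ k, Y k ∈ hyperplaneInter x k) (hd : ∀ k, (frame Y k).det ≠ 0) (k : ℤ) :
    hyperplane x k = Submodule.span ℝ (Y '' Set.Icc (k - s) (k + s)) :=
  (Submodule.eq_of_le_of_finrank_le (span_window_le_hyperplane hY k)
    (by rw [finrank_span_window hd]; exact finrank_hyperplane_le hV k)).symm

/-- Each `P_j` is spanned by a window of `2s+1` consecutive `Y`'s centred at `j`, so intersecting
consecutive ones removes one vector at a time until only `Y k` is left. -/
theorem hyperplaneInter_eq_span
    (hV : ∀ k, ∃ h : V k ≠ 0, Projectivization.mk ℝ (V k) h = x k)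
    (hY : ∀ k, Y k ∈ hyperplaneInter x k) (hd : ∀ k, (frame Y k).det ≠ 0) (k : ℤ) :
    hyperplaneInter x k = Submodule.span ℝ {Y k} := by
  refine le_antisymm (fun v hv => ?_) (by simpa using hY k)
  have key : ∀ r : ℕ, r ≤ 2 * s →
      v ∈ Submodule.span ℝ (Y '' Set.Icc (k - 2 * s + r) k) := by
    intro r
    induction r with
    | zero =>
      intro _
      have := mem_hyperplane_of_mem_inter hv (j := k - s) (by lia) (by lia)
      rw [hyperplane_eq_span_window hV hY hd] at this
      convert this using 4 <;> push_cast <;> ring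
    | succ r ih =>
      intro hr
      have h1 := mem_hyperplane_of_mem_inter hv (j := k - s + r + 1) (by lia) (by lia)
      rw [hyperplane_eq_span_window hV hY hd] at h1
      have h2 := span_image_inf (linearIndepOn_window (hd (k - 2 * s + r)))
        (Set.Icc_subset_Icc le_rfl (by lia)) (Set.Icc_subset_Icc (by lia) (by lia)) (ih (by lia)) h1
      refine Submodule.span_mono (Set.image_mono ?_) h2
      rintro i ⟨⟨_, _⟩, ⟨_, _⟩⟩
      exact ⟨by lia, by lia⟩
  have := key (2 * s) le_rfl
  have e : Set.Icc (k - 2 * (s : ℤ) + ((2 * s : ℕ) : ℤ)) k = {k} := by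
    rw [show k - 2 * (s : ℤ) + ((2 * s : ℕ) : ℤ) = k by push_cast; ring, Set.Icc_self]
  rwa [e, Set.image_singleton] at this

theorem ne_zero_of_det_frame {Y : ℤ → Vec s} {k : ℤ} (h : (frame Y k).det ≠ 0) : Y k ≠ 0 :=
  (linearIndepOn_window h).ne_zero ⟨le_rfl, by lia⟩

theorem isGeneric_of_mem_inter
    (hV : ∀ k, ∃ h : V k ≠ 0, Projectivization.mk ℝ (V k) h = x k)
    (hY : ∀ k, Y k ∈ hyperplaneInter x k) (hd : ∀ k, (frame Y k).det ≠ 0) : IsGeneric x where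
  finrank_hyperplane k := by
    rw [hyperplane_eq_span_window hV hY hd, finrank_span_window hd]
  finrank_inter k := by
    rw [hyperplaneInter_eq_span hV hY hd, finrank_span_singleton (ne_zero_of_det_frame (hd k))]

/-- The `2s+2` vectors `V` span two hyperplanes, `P_{k+2s}` and `P_{k+2s+2}`. For `s ≥ 1` these
together contain a full window of `Y`'s, which is a basis. -/
theorem linearIndepOn_step (hs : 1 ≤ s)
    (hV : ∀ k, ∃ h : V k ≠ 0, Projectivization.mk ℝ (V k) h = x k)
    (hY : ∀ k, Y k ∈ hyperplaneInter x k) (hd : ∀ k, (frame Y k).det ≠ 0) (k : ℤ) :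
    LinearIndepOn ℝ V (stepSet k (k + 2 * (2 * s + 1 : ℕ))) := by
  rw [← range_step, linearIndepOn_range_iff (fun a b hab => by
    simp only [add_right_inj, mul_eq_mul_left_iff, Nat.cast_inj] at hab
    exact Fin.ext (by simpa using hab))]
  refine linearIndependent_of_top_le_span_of_card_eq_finrank ?_ (by simp)
  rw [Set.range_comp, range_step]
  have htop : Submodule.span ℝ (Y '' Set.Icc (k + s) (k + s + (2 * s + 1 : ℕ))) = ⊤ := by
    have hi := linearIndepOn_window (hd (k + s))
    rw [← range_window, linearIndepOn_range_iff (fun a b hab => by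
      simp only [add_right_inj, Nat.cast_inj] at hab; exact Fin.ext hab)] at hi
    rw [← range_window, ← Set.range_comp]
    exact hi.span_eq_top_of_card_eq_finrank (by simp)
  rw [← htop, Submodule.span_le]
  rintro _ ⟨j, ⟨h1, h2⟩, rfl⟩
  rcases le_or_gt j (k + 3 * s) with h3 | h3
  · have := mem_hyperplane_of_mem_inter (hY j) (j := k + 2 * s) (by lia) (by lia)
    rw [hyperplane_eq_span hV] at this
    exact Submodule.span_mono (Set.image_mono
      (stepSet_subset (by lia) (by lia) (by lia))) this
  · have := mem_hyperplane_of_mem_inter (hY j) (j := k + 2 * s + 2) (by lia) (by lia)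
    rw [hyperplane_eq_span hV] at this
    exact Submodule.span_mono (Set.image_mono
      (stepSet_subset (by lia) (by lia) (by lia))) this

end Transversal

/-! ### The recurrence split by parity. -/

section Operators

variable {s : ℕ}

/-- The formal combination `∑_{i odd} a_k^i e_{k+i}`. -/
noncomputable def oddPart (a : Coords s) (k : ℤ) : ℤ →₀ ℝ :=
  ∑ j : Fin (2 * s + 1), (if Odd ((j : ℕ) + 1) then a k j else 0) • single (k + ((j : ℤ) + 1)) 1

/-- The formal combination `e_{k+n+1} + e_k - ∑_{i even} a_k^i e_{k+i}`. -/
noncomputable def evenPart (a : Coords s) (k : ℤ) : ℤ →₀ ℝ :=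
  single (k + (2 * s + 2)) 1 + single k 1 -
    ∑ j : Fin (2 * s + 1), (if Odd ((j : ℕ) + 1) then 0 else a k j) • single (k + ((j : ℤ) + 1)) 1

theorem oddPart_scaling (t : ℝ) (a : Coords s) (k : ℤ) :
    oddPart (scaling t a) k = t • oddPart a k := by
  simp only [oddPart, scaling, Finset.smul_sum, smul_smul]
  refine Finset.sum_congr rfl fun j _ => ?_
  split_ifs <;> simp

theorem evenPart_scaling (t : ℝ) (a : Coords s) (k : ℤ) :
    evenPart (scaling t a) k = evenPart a k := by
  simp only [evenPart, scaling]
  congr 1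
  refine Finset.sum_congr rfl fun j _ => ?_
  split_ifs <;> simp

theorem single_mem_supported {S : Set ℤ} {i : ℤ} (hi : i ∈ S) (c : ℝ) :
    single i c ∈ supported ℝ ℝ S :=
  Finsupp.single_mem_supported ℝ c hi

theorem oddPart_mem (a : Coords s) (k : ℤ) :
    oddPart a k ∈ supported ℝ ℝ (stepSet (k + 1) (k + 1 + 2 * s)) := by
  refine Submodule.sum_mem _ fun j _ => ?_
  have := j.2
  split_ifs with h
  · refine Submodule.smul_mem _ _ (single_mem_supported ?_ _)
    have := Nat.odd_iff.1 h
    exact ⟨by lia, by lia, by lia⟩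
  · simp

theorem evenPart_mem (a : Coords s) (k : ℤ) :
    evenPart a k ∈ supported ℝ ℝ (stepSet k (k + 2 * s + 2)) := by
  refine Submodule.sub_mem _ (Submodule.add_mem _ (single_mem_supported ?_ _)
    (single_mem_supported ?_ _)) (Submodule.sum_mem _ fun j _ => ?_)
  · exact ⟨by lia, by lia, by lia⟩
  · exact ⟨by lia, by lia, by lia⟩
  have := j.2
  split_ifs with h
  · simp
  · refine Submodule.smul_mem _ _ (single_mem_supported ?_ _)
    have := Nat.odd_iff.not.1 h
    exact ⟨by lia, by lia, by lia⟩

/-- `V` satisfies the recurrence with coefficients `a`. -/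
def Recurrence (a : Coords s) (V : ℤ → Vec s) : Prop :=
  ∀ k : ℤ, V (k + (2 * s + 2)) =
    (∑ j : Fin (2 * s + 1), a k j • V (k + ((j : ℤ) + 1))) + (-1 : ℝ) ^ (2 * s + 1) • V k

theorem recurrence_iff {a : Coords s} {V : ℤ → Vec s} :
    Recurrence a V ↔ ∀ k, linearCombination ℝ V (evenPart a k) =
      linearCombination ℝ V (oddPart a k) := by
  refine forall_congr' fun k => ?_
  have hp : (-1 : ℝ) ^ (2 * s + 1) = -1 := by simp [pow_succ, pow_mul]
  have hsum : ∑ j : Fin (2 * s + 1), a k j • V (k + ((j : ℤ) + 1)) =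
      (∑ j : Fin (2 * s + 1), (if Odd ((j : ℕ) + 1) then a k j else 0) • V (k + ((j : ℤ) + 1))) +
      ∑ j : Fin (2 * s + 1), (if Odd ((j : ℕ) + 1) then 0 else a k j) • V (k + ((j : ℤ) + 1)) := by
    rw [← Finset.sum_add_distrib]
    refine Finset.sum_congr rfl fun j _ => ?_
    split_ifs <;> simp
  simp only [evenPart, oddPart, map_sub, map_add, map_sum, map_smul,
    Finsupp.linearCombination_single, one_smul]
  rw [hp, hsum]
  constructor
  · intro h
    rw [h]
    module
  · intro h
    rw [← h]
    module

theorem coords_unique {a b : Coords s} {V : ℤ → Vec s} (hd : ∀ k, (frame V k).det ≠ 0)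
    {k : ℤ} (h : ∑ j : Fin (2 * s + 1), a k j • V (k + ((j : ℤ) + 1)) =
      ∑ j : Fin (2 * s + 1), b k j • V (k + ((j : ℤ) + 1))) : a k = b k := by
  have hi := (linearIndepOn_window (hd (k + 1))).mono
    (t := Set.Icc (k + 1) (k + 1 + (2 * s : ℕ))) (Set.Icc_subset_Icc le_rfl (by lia))
  rw [← range_window, linearIndepOn_range_iff (fun a b hab => by
    simp only [add_right_inj, Nat.cast_inj] at hab; exact Fin.ext hab)] at hi
  have := Fintype.linearIndependent_iff.1 hi (fun j => a k j - b k j) (by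
    simp only [Function.comp_apply, sub_smul, Finset.sum_sub_distrib]
    rw [sub_eq_zero]
    convert h using 4 <;> ring)
  exact funext fun j => sub_eq_zero.1 (this j)

theorem smul_vec_eq (g : SLn s) (v : Vec s) : g • v = g.1.mulVec v := rfl

theorem coords_periodic {N : ℕ} {g : SLn s} {a : Coords s} {V : ℤ → Vec s}
    (hd : ∀ k, (frame V k).det ≠ 0) (hg : ∀ k, V (k + N) = g • V k) (h : Recurrence a V) (k : ℤ) :
    a (k + N) = a k := by
  refine coords_unique (a := a) (b := fun k => a (k - N)) hd (k := k + N) ?_ |>.trans (by simp)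
  have h1 := h (k + N)
  have h2 := congrArg (fun v => g • v) (h k)
  simp only [smul_vec_eq, Matrix.mulVec_add, Matrix.mulVec_smul, Matrix.mulVec_sum] at h2
  simp only [← smul_vec_eq, ← hg] at h2
  rw [show k + N + (2 * (s : ℤ) + 2) = k + (2 * s + 2) + N by ring, h2] at h1
  have h3 := add_right_cancel h1
  rw [← h3, add_sub_cancel_right]
  refine Finset.sum_congr rfl fun j _ => ?_
  congr 2
  ring

theorem linearCombination_oddPart_periodic {N : ℕ} {g : SLn s} {a : Coords s} {V : ℤ → Vec s}
    (ha : ∀ k, a (k + N) = a k) (hg : ∀ k, V (k + N) = g • V k) (k : ℤ) :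
    linearCombination ℝ V (oddPart a (k + N)) = g • linearCombination ℝ V (oddPart a k) := by
  simp only [oddPart, map_sum, map_smul, Finsupp.linearCombination_single, one_smul, smul_vec_eq,
    Matrix.mulVec_smul, Matrix.mulVec_sum]
  refine Finset.sum_congr rfl fun j _ => ?_
  rw [← smul_vec_eq, ← hg, ha]
  congr 2
  ring

/-- Up to the factor `t`, the odd and even parts give the same vector. One expression or the other
uses only vertices of `P_j`, according to the parity of `j`. -/
theorem linearCombination_oddPart_mem_inter {t : ℝ} {x : ℤ → RP s} {a : Coords s}
    {V : ℤ → Vec s} (hV : ∀ k, ∃ h : V k ≠ 0, Projectivization.mk ℝ (V k) h = x k) (ht : t ≠ 0)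
    (h : ∀ k, linearCombination ℝ V (evenPart a k) = t • linearCombination ℝ V (oddPart a k))
    (k : ℤ) :
    linearCombination ℝ V (oddPart a (k - s - 1)) ∈ hyperplaneInter x k := by
  rw [mem_inter_iff]
  intro j h1 h2
  rw [hyperplane_eq_span hV]
  rcases Int.emod_two_eq_zero_or_one (k + s - j) with h3 | h3
  · exact Submodule.span_mono (Set.image_mono (stepSet_subset (by lia) (by lia) (by lia)))
      (linearCombination_mem_span V (oddPart_mem a _))
  · have := linearCombination_mem_span V (evenPart_mem a (k - s - 1))
    rw [h, Submodule.smul_mem_iff _ ht] at this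
    exact Submodule.span_mono (Set.image_mono (stepSet_subset (by lia) (by lia) (by lia))) this

end Operators

/-! ### The frame determinant of the image as a Sylvester-type determinant. -/

section Determinant

variable {s : ℕ}

/-- The two consecutive windows of length `n + 1` starting at `k`. -/
def doubleWindow (s : ℕ) (k : ℤ) : Fin (2 * s + 2) ⊕ Fin (2 * s + 2) → ℤ :=
  Sum.elim (fun i => k + (i : ℤ)) (fun i => k + (2 * s + 2) + (i : ℤ))

theorem doubleWindow_injective (s : ℕ) (k : ℤ) : Function.Injective (doubleWindow s k) := by
  rintro (i | i) (j | j) h <;> have := i.2 <;> have := j.2 <;>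
    simp only [doubleWindow, Sum.elim_inl, Sum.elim_inr] at h
  · rw [Fin.ext (show (i : ℕ) = j by lia)]
  · omega
  · omega
  · rw [Fin.ext (show (i : ℕ) = j by lia)]

theorem linearCombination_eq_sum_doubleWindow {M : Type*} [AddCommGroup M] [Module ℝ M]
    (V : ℤ → M) {k : ℤ} {f : ℤ →₀ ℝ} (hf : f ∈ supported ℝ ℝ (Set.Ico k (k + 2 * (2 * s + 2)))) :
    linearCombination ℝ V f = ∑ p, f (doubleWindow s k p) • V (doubleWindow s k p) := by
  rw [Finsupp.linearCombination_apply, Finsupp.sum_of_support_subset f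
    (s := Finset.univ.image (doubleWindow s k)) ?_ _ (by simp),
    Finset.sum_image fun _ _ _ _ h => doubleWindow_injective s k h]
  intro i hi
  obtain ⟨h1, h2⟩ := hf hi
  rw [Finset.mem_image]
  by_cases h : i < k + (2 * s + 2)
  · exact ⟨Sum.inl ⟨(i - k).toNat, by lia⟩, Finset.mem_univ _, by simp [doubleWindow]; lia⟩
  · exact ⟨Sum.inr ⟨(i - (k + (2 * s + 2))).toNat, by lia⟩, Finset.mem_univ _,
      by simp [doubleWindow]; lia⟩

/-- The matrix of coefficients of the families `u`, `w` on a double window. -/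
def coeffMatrix (k : ℤ) (u w : Fin (2 * s + 2) → ℤ →₀ ℝ) :
    Matrix (Fin (2 * s + 2) ⊕ Fin (2 * s + 2)) (Fin (2 * s + 2) ⊕ Fin (2 * s + 2)) ℝ :=
  Matrix.of fun r p => (Sum.elim u w r) (doubleWindow s k p)

theorem det_linearCombination {V : ℤ → Vec s} {k : ℤ} {u w : Fin (2 * s + 2) → ℤ →₀ ℝ}
    (hV : (frame V k).det = 1)
    (hu : ∀ i, u i ∈ supported ℝ ℝ (Set.Ico k (k + 2 * (2 * s + 2))))
    (hw : ∀ i, w i ∈ supported ℝ ℝ (Set.Ico k (k + 2 * (2 * s + 2))))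
    (hw0 : ∀ i, linearCombination ℝ V (w i) = 0)
    (hw1 : ∀ i, w i (k + (2 * s + 2) + (i : ℤ)) = 1)
    (hw2 : ∀ i j : Fin (2 * s + 2), i < j → w i (k + (2 * s + 2) + (j : ℤ)) = 0) :
    (Matrix.of fun i => linearCombination ℝ V (u i)).det = (coeffMatrix k u w).det := by
  -- Right multiplication by `X` evaluates each row of coefficients on `V` in the left block and
  -- keeps its second-window coefficients in the right block. The relations `w` evaluate to zero, so
  -- the product is block triangular with a unipotent lower block.
  set X : Matrix (Fin (2 * s + 2) ⊕ Fin (2 * s + 2)) (Fin (2 * s + 2) ⊕ Fin (2 * s + 2)) ℝ :=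
    Matrix.fromBlocks (Matrix.of fun i => V (k + (i : ℤ))) 0
      (Matrix.of fun i => V (k + (2 * s + 2) + (i : ℤ))) 1 with hX
  have hXdet : X.det = 1 := by
    rw [hX, Matrix.det_fromBlocks_zero₁₂, Matrix.det_one, mul_one, ← hV, ← Matrix.det_transpose]
    rfl
  have hmul : coeffMatrix k u w * X = Matrix.fromBlocks
      (Matrix.of fun i => linearCombination ℝ V (u i))
      (Matrix.of fun i (j : Fin (2 * s + 2)) => u i (k + (2 * s + 2) + (j : ℤ))) 0
      (Matrix.of fun i (j : Fin (2 * s + 2)) => w i (k + (2 * s + 2) + (j : ℤ))) := by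
    ext r p
    rcases r with i | i <;> rcases p with j | j
    · simp [Matrix.mul_apply, hX, coeffMatrix, linearCombination_eq_sum_doubleWindow V (hu i),
        doubleWindow]
    · simp [Matrix.mul_apply, hX, coeffMatrix, doubleWindow, Matrix.one_apply]
    · have := congrFun (hw0 i) j
      rw [linearCombination_eq_sum_doubleWindow V (hw i)] at this
      simpa [Matrix.mul_apply, hX, coeffMatrix, doubleWindow] using this
    · simp [Matrix.mul_apply, hX, coeffMatrix, doubleWindow, Matrix.one_apply]
  have hlow : (Matrix.of fun i (j : Fin (2 * s + 2)) => w i (k + (2 * s + 2) + (j : ℤ))).det = 1 := by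
    refine (Matrix.det_of_isLowerTriangular (Matrix.of _) fun i j h => hw2 i j h).trans ?_
    exact Finset.prod_eq_one fun i _ => hw1 i
  have := congrArg Matrix.det hmul
  rwa [Matrix.det_mul, hXdet, mul_one, Matrix.det_fromBlocks_zero₂₁, hlow, mul_one,
    eq_comm] at this

theorem det_coeffMatrix_sub_smul (k : ℤ) (u w : Fin (2 * s + 2) → ℤ →₀ ℝ) (t : ℝ) :
    (coeffMatrix k u (fun i => w i - t • u i)).det = (coeffMatrix k u w).det := by
  have : coeffMatrix k u (fun i => w i - t • u i) =
      Matrix.fromBlocks 1 0 (-t • (1 : Matrix (Fin (2 * s + 2)) (Fin (2 * s + 2)) ℝ)) 1 *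
        coeffMatrix k u w := by
    ext r p
    rcases r with i | i <;>
      simp [coeffMatrix, Matrix.mul_apply, Matrix.one_apply, sub_eq_neg_add]
  rw [this, Matrix.det_mul, Matrix.det_fromBlocks_zero₁₂]
  simp

theorem oddPart_apply_top (a : Coords s) (k : ℤ) : oddPart a k (k + (2 * s + 2)) = 0 := by
  by_contra h
  have := oddPart_mem a k (Finsupp.mem_support_iff.2 h)
  have := this.2.1
  lia

theorem evenPart_apply_top (a : Coords s) (k : ℤ) : evenPart a k (k + (2 * s + 2)) = 1 := by
  have h1 : ∀ j : Fin (2 * s + 1), k + ((j : ℤ) + 1) ≠ k + (2 * s + 2) := fun j => by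
    have := j.2
    lia
  have h2 : k ≠ k + (2 * s + 2) := by lia
  simp only [evenPart, Finsupp.sub_apply, Finsupp.add_apply, Finsupp.single_eq_same,
    Finsupp.finsetSum_apply, Finsupp.smul_apply]
  rw [Finset.sum_eq_zero fun j _ => by
    rw [Finsupp.single_eq_of_ne (h1 j).symm, smul_zero], Finsupp.single_eq_of_ne h2.symm]
  simp

/-- The determinant of Sylvester type of the odd and even parts of the recurrence operator. -/
noncomputable def resultant (a : Coords s) (k : ℤ) : ℝ :=
  (coeffMatrix k (fun i : Fin (2 * s + 2) => oddPart a (k + (i : ℤ)))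
    (fun i => evenPart a (k + (i : ℤ)))).det

/-- The relations satisfied by `V` are `E - t O`. Row operations with the rows `O` remove the `t O`,
so the determinant does not depend on `t`. -/
theorem det_frame_oddPart {V : ℤ → Vec s} {a : Coords s} {t : ℝ}
    (hV : ∀ k, (frame V k).det = 1)
    (h : ∀ k, linearCombination ℝ V (evenPart a k) = t • linearCombination ℝ V (oddPart a k))
    (k : ℤ) :
    (frame (fun j => linearCombination ℝ V (oddPart a (j - s - 1))) k).det =
      resultant a (k - s - 1) := by
  have ho : ∀ i : ℤ, oddPart a i ∈ supported ℝ ℝ (Set.Icc i (i + 2 * s + 2)) := by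
    refine fun i => Finsupp.supported_mono ?_ (oddPart_mem a i)
    rintro j ⟨h1, h2, _⟩
    exact ⟨by lia, by lia⟩
  have he : ∀ i : ℤ, evenPart a i ∈ supported ℝ ℝ (Set.Icc i (i + 2 * s + 2)) := by
    refine fun i => Finsupp.supported_mono ?_ (evenPart_mem a i)
    rintro j ⟨h1, h2, _⟩
    exact ⟨h1, h2⟩
  have hl := fun i => sub_mem (he i) (Submodule.smul_mem _ t (ho i))
  rw [resultant, ← det_coeffMatrix_sub_smul _ _ _ t, ← det_linearCombination (hV _)]
  · rw [← Matrix.det_transpose]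
    congr 1
    ext i j
    simp only [frame, Matrix.transpose_apply, Matrix.of_apply]
    rw [show k + (i : ℤ) - s - 1 = k - s - 1 + i by ring]
  · intro i
    have := i.2
    exact Finsupp.supported_mono (Set.Icc_subset_Ico (by lia) (by lia)) (ho _)
  · intro i
    have := i.2
    exact Finsupp.supported_mono (Set.Icc_subset_Ico (by lia) (by lia)) (hl _)
  · intro i
    simp [h]
  · intro i
    rw [show k - s - 1 + (2 * (s : ℤ) + 2) + (i : ℤ) = k - s - 1 + (i : ℤ) + (2 * s + 2) by ring]
    simp [evenPart_apply_top, oddPart_apply_top]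
  · intro i j hij
    by_contra hne
    have := (hl _ (Finsupp.mem_support_iff.2 hne)).2
    have : (i : ℕ) < j := hij
    omega

theorem det_frame_smul (c : ℤ → ℝ) (U : ℤ → Vec s) (k : ℤ) :
    (frame (fun j => c j • U j) k).det =
      (∏ i : Fin (2 * s + 2), c (k + (i : ℤ))) * (frame U k).det := by
  rw [← Matrix.det_mul_row]
  rfl

end Determinant

/-! ### A polygon with prescribed periodic invariants. -/

section Existence

variable {s : ℕ}

theorem exists_right_product {G : Type*} [Group G] (C : ℤ → G) :
    ∃ F : ℤ → G, F 0 = 1 ∧ ∀ k, F (k + 1) = F k * C k := by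
  let f : ℕ → G := fun n => Nat.rec 1 (fun n y => y * C n) n
  let g : ℕ → G := fun n => Nat.rec 1 (fun n y => y * (C (-(n + 1)))⁻¹) n
  refine ⟨fun k => if 0 ≤ k then f k.toNat else g (-k).toNat, rfl, fun k => ?_⟩
  rcases lt_trichotomy k (-1) with h | rfl | h
  · have e : (-k).toNat = (-(k + 1)).toNat + 1 := by lia
    simp only [show ¬ 0 ≤ k + 1 by lia, show ¬ 0 ≤ k by lia, if_false, e]
    change _ = g _ * (C _)⁻¹ * C k
    rw [show (-((((-(k + 1)).toNat : ℕ) : ℤ) + 1)) = k by lia, inv_mul_cancel_right]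
  · change (1 : G) = 1 * (C (-(0 + 1)))⁻¹ * C (-1)
    simp
  · have e : (k + 1).toNat = k.toNat + 1 := by lia
    simp only [show 0 ≤ k + 1 by lia, show 0 ≤ k by lia, if_true, e]
    change f _ * C _ = _
    rw [show ((k.toNat : ℕ) : ℤ) = k by lia]

/-- The companion matrix which sends a frame to the next one. -/
def companion (a : Coords s) (k : ℤ) : Matrix (Fin (2 * s + 1 + 1)) (Fin (2 * s + 1 + 1)) ℝ :=
  Matrix.of fun i => Fin.snoc (α := fun _ => ℝ)
    (fun j : Fin (2 * s + 1) => if i = j.succ then 1 else 0)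
    (Fin.cons (α := fun _ => ℝ) (-1) (a k) i)

theorem det_companion (a : Coords s) (k : ℤ) : (companion a k).det = 1 := by
  rw [Matrix.det_succ_row_zero, Fin.sum_univ_castSucc, Finset.sum_eq_zero, zero_add]
  · have : (companion a k).submatrix Fin.succ (Fin.last (2 * s + 1)).succAbove = 1 := by
      ext i j
      simp [companion, Matrix.one_apply]
    rw [this]
    simp [companion, pow_succ, pow_mul]
  · intro j _
    simp [companion, (Fin.succ_ne_zero j).symm]

/-- The frames are the partial products `F k` of the companion matrices. Periodicity of `a` gives `F
(k + N) = F N * F k`, so `F N` is the monodromy, and `V k` is the first column of `F k`. -/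
theorem exists_recurrence {N : ℕ} {a : Coords s} (ha : ∀ k, a (k + N) = a k) :
    ∃ (g : SLn s) (x : ℤ → RP s), HasInvariants N g x a := by
  let C : ℤ → SLn s := fun k => ⟨companion a k, det_companion a k⟩
  obtain ⟨F, hF0, hF⟩ := exists_right_product C
  have hF' : ∀ k, (F (k + 1)).1 = (F k).1 * companion a k := fun k => by
    rw [hF]
    rfl
  have hper : ∀ k, F (k + N) = F N * F k := by
    have hC : ∀ k, C (k + N) = C k := fun k => Subtype.ext (by simp [C, companion, ha])
    have step : ∀ k, F (k + N) * (F k)⁻¹ = F (k + 1 + N) * (F (k + 1))⁻¹ := fun k => by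
      rw [show k + 1 + N = k + N + 1 by ring, hF, hF k, hC]
      group
    have hconst : ∀ k, F (k + N) * (F k)⁻¹ = F N := fun k => by
      induction k using Int.induction_on with
      | zero => simp [hF0]
      | succ n ih => rw [← step, ih]
      | pred n ih => rw [step, sub_add_cancel, ih]
    intro k
    rw [← hconst k, inv_mul_cancel_right]
  let V : ℤ → Vec s := fun k i => (F k).1 i 0
  have hshift : ∀ k (j : Fin (2 * s + 1)) i,
      (F (k + 1)).1 i j.castSucc = (F k).1 i j.succ := fun k j i => by
    rw [hF', Matrix.mul_apply]
    simp [companion]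
  have hcol : ∀ (j : ℕ) (hj : j < 2 * s + 2) k i, V (k + j) i = (F k).1 i ⟨j, hj⟩ := by
    intro j
    induction j with
    | zero => intro _ k i; simp [V]
    | succ j ih =>
      intro hj k i
      have := ih (by lia) (k + 1) i
      rw [show k + ((j + 1 : ℕ) : ℤ) = k + 1 + j by push_cast; ring, this]
      exact hshift k ⟨j, by lia⟩ i
  have hframe : ∀ k, frame V k = (F k).1 := fun k => by
    ext i j
    exact hcol j j.2 k i
  have hdet : ∀ k, (frame V k).det = 1 := fun k => by rw [hframe, (F k).2]
  have hne : ∀ k, V k ≠ 0 := fun k => ne_zero_of_det_frame (by rw [hdet]; exact one_ne_zero)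
  refine ⟨F N, fun k => Projectivization.mk ℝ (V k) (hne k), V,
    ⟨fun k => ⟨hne k, rfl⟩, hdet, fun k => ?_⟩, fun k => ?_⟩
  · ext i
    have := congrFun (congrFun (congrArg Subtype.val (hper k)) i) 0
    simpa [smul_vec_eq, V, Matrix.mulVec, dotProduct, Matrix.mul_apply] using this
  · ext i
    have h1 := hcol (2 * s + 1) (by lia) (k + 1) i
    rw [hF', Matrix.mul_apply, Fin.sum_univ_succ] at h1
    rw [show k + (2 * (s : ℤ) + 2) = k + 1 + ((2 * s + 1 : ℕ) : ℤ) by push_cast; ring, h1]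
    have hl : (⟨2 * s + 1, by lia⟩ : Fin (2 * s + 2)) = Fin.last _ := rfl
    have h2 : ∀ j : Fin (2 * s + 1), V (k + ((j : ℤ) + 1)) i = (F k).1 i j.succ := fun j => by
      rw [← Nat.cast_succ]
      exact hcol _ j.succ.2 k i
    simp only [companion, Matrix.of_apply, hl, Fin.snoc_last, Fin.cons_zero, Fin.cons_succ,
      Pi.add_apply, Finset.sum_apply, Pi.smul_apply, smul_eq_mul, h2]
    rw [add_comm]
    congr 1
    · exact Finset.sum_congr rfl fun j _ => mul_comm _ _
    · simp [V, pow_succ, pow_mul]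

end Existence

/-! ### Lifts of the image polygon, and transfer between polygons. -/

section Lifts

variable {s N : ℕ}

theorem recurrence_scaling_iff {t : ℝ} {a : Coords s} {V : ℤ → Vec s} :
    Recurrence (scaling t a) V ↔ ∀ k, linearCombination ℝ V (evenPart a k) =
      t • linearCombination ℝ V (oddPart a k) := by
  simp only [recurrence_iff, evenPart_scaling, oddPart_scaling, map_smul]

theorem scaling_one (a : Coords s) : scaling 1 a = a := by
  funext k j
  simp [scaling]

theorem scaling_scaling (t u : ℝ) (a : Coords s) : scaling t (scaling u a) = scaling (t * u) a := by
  funext k j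
  simp only [scaling]
  split_ifs <;> ring

theorem linearCombination_mem_supported {S T : Set ℤ} {u : ℤ → ℤ →₀ ℝ} {f : ℤ →₀ ℝ}
    (hf : f ∈ supported ℝ ℝ S) (hu : ∀ j ∈ S, u j ∈ supported ℝ ℝ T) :
    linearCombination ℝ u f ∈ supported ℝ ℝ T := by
  refine Submodule.span_le.2 ?_ (linearCombination_mem_span u hf)
  rintro _ ⟨j, hj, rfl⟩
  exact hu j hj

/-- The normalizing factors `c` turn the odd part of the recurrence with coefficients `a` into
an operator which carries solutions to solutions of the recurrence with coefficients `b`. -/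
structure Intertwines (N : ℕ) (a b : Coords s) (c : ℤ → ℝ) : Prop where
  periodic : ∀ k, c (k + N) = c k
  det : ∀ k, (∏ i : Fin (2 * s + 2), c (k + (i : ℤ))) * resultant a (k - s - 1) = 1
  comm : ∀ k, linearCombination ℝ (fun j => c j • oddPart a (j - s - 1)) (evenPart b k) =
    linearCombination ℝ (fun j => c j • evenPart a (j - s - 1)) (oddPart b k)

theorem pentagramMap_eq_mk {x : ℤ → RP s} (hx : IsGeneric x) {k : ℤ} {w : Vec s} (hw : w ≠ 0)
    (h : w ∈ hyperplaneInter x k) : Projectivization.mk ℝ w hw = pentagramMap x hx k := by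
  apply Projectivization.submodule_injective
  rw [Projectivization.submodule_mk, pentagramMap, Projectivization.submodule_mk'']
  exact Submodule.eq_of_le_of_finrank_le ((Submodule.span_singleton_le_iff_mem _ _).2 h)
    (by rw [hx.finrank_inter, finrank_span_singleton hw])

theorem mem_hyperplaneInter_of_mk_eq {x : ℤ → RP s} {hx : IsGeneric x} {k : ℤ} {w : Vec s}
    {hw : w ≠ 0} (h : Projectivization.mk ℝ w hw = pentagramMap x hx k) :
    w ∈ hyperplaneInter x k := by
  have := congrArg Projectivization.submodule h
  rw [Projectivization.submodule_mk, pentagramMap, Projectivization.submodule_mk''] at this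
  rw [← this]
  exact Submodule.mem_span_singleton_self w

/-- On a solution of `E^a = t O^a`, the intertwining identity gives `E^b(cU) = O^b(c E^a V) = t
O^b(cU)`. The same `c` therefore serves every `t`. -/
theorem hasInvariants_pentagramMap_of_intertwines {a b : Coords s} {c : ℤ → ℝ}
    (hc : Intertwines N a b c) {t : ℝ} (ht : t ≠ 0) {g : SLn s} {x : ℤ → RP s}
    (hx : HasInvariants N g x (scaling t a)) :
    ∃ hg : IsGeneric x, HasInvariants N g (pentagramMap x hg) (scaling t b) := by
  obtain ⟨V, hV, hrec⟩ := hx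
  have hne : ∀ k, (frame V k).det ≠ 0 := fun k => by rw [hV.det_eq_one]; exact one_ne_zero
  have hper : ∀ k, a (k + N) = a k := fun k => by
    have := coords_periodic hne hV.monodromy hrec
    have h1 : ∀ k, scaling t⁻¹ (scaling t a) (k + N) = scaling t⁻¹ (scaling t a) k := fun k => by
      funext j
      simp only [scaling]
      have := congrFun (this k) j
      simp only [scaling] at this
      rw [this]
    rw [scaling_scaling, inv_mul_cancel₀ ht, scaling_one] at h1
    exact h1 k
  have hEO := recurrence_scaling_iff.1 hrec
  set U : ℤ → Vec s := fun j => linearCombination ℝ V (oddPart a (j - s - 1)) with hU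
  have hUmem : ∀ k, U k ∈ hyperplaneInter x k :=
    linearCombination_oddPart_mem_inter hV.represents ht hEO
  have hUdet : ∀ k, (frame U k).det ≠ 0 := fun k => by
    rw [det_frame_oddPart hV.det_eq_one hEO]
    exact right_ne_zero_of_mul_eq_one (hc.det k)
  have hWdet : ∀ k, (frame (fun j => c j • U j) k).det = 1 := fun k => by
    rw [det_frame_smul, det_frame_oddPart hV.det_eq_one hEO, hc.det]
  have hg := isGeneric_of_mem_inter hV.represents hUmem hUdet
  refine ⟨hg, fun j => c j • U j, ⟨fun k => ?_, hWdet, fun k => ?_⟩, ?_⟩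
  · have : c k • U k ≠ 0 := ne_zero_of_det_frame (Y := fun j => c j • U j)
      (by rw [hWdet]; exact one_ne_zero)
    exact ⟨this, pentagramMap_eq_mk hg this (Submodule.smul_mem _ _ (hUmem k))⟩
  · simp only [hc.periodic, hU]
    rw [show k + N - (s : ℤ) - 1 = k - s - 1 + N by ring,
      linearCombination_oddPart_periodic hper hV.monodromy, smul_vec_eq, smul_vec_eq,
      Matrix.mulVec_smul]
  · change Recurrence (scaling t b) fun j => c j • U j
    refine recurrence_scaling_iff.2 fun k => ?_
    have h := congrArg (linearCombination ℝ V) (hc.comm k)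
    simp only [Finsupp.linearCombination_linearCombination, map_smul, hEO] at h
    rw [h, ← map_smul, Finsupp.linearCombination_apply, Finsupp.linearCombination_apply,
      Finsupp.sum_smul_index (by simp)]
    refine Finset.sum_congr rfl fun j _ => ?_
    simp only [hU, smul_smul]
    congr 1
    ring

/-- The factor `c` compares the given lift of `T(x)` with `U`. The intertwining identity holds after
evaluation on `V`, and it lifts to formal combinations because both sides are supported on `n+1`
indices of one parity, where `V` is independent. -/
theorem exists_intertwines (hs : 1 ≤ s) {a b : Coords s} {g : SLn s} {x : ℤ → RP s}
    {hx : IsGeneric x} (ha : HasInvariants N g x a)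
    (hb : HasInvariants N g (pentagramMap x hx) b) : ∃ c, Intertwines N a b c := by
  obtain ⟨V, hV, hrec⟩ := ha
  obtain ⟨W, hW, hrecW⟩ := hb
  have hne : ∀ k, (frame V k).det ≠ 0 := fun k => by rw [hV.det_eq_one]; exact one_ne_zero
  have hneW : ∀ k, (frame W k).det ≠ 0 := fun k => by rw [hW.det_eq_one]; exact one_ne_zero
  have hEO := recurrence_iff.1 hrec
  have hEO' : ∀ k, linearCombination ℝ V (evenPart a k) =
      (1 : ℝ) • linearCombination ℝ V (oddPart a k) := by simpa using hEO
  have hper := coords_periodic hne hV.monodromy hrec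
  have hWmem : ∀ k, W k ∈ hyperplaneInter x k := fun k => by
    obtain ⟨h, e⟩ := hW.represents k
    exact mem_hyperplaneInter_of_mk_eq e
  have hstep := linearIndepOn_step hs hV.represents hWmem hneW
  set U : ℤ → Vec s := fun j => linearCombination ℝ V (oddPart a (j - s - 1)) with hU
  have hUne : ∀ k, U k ≠ 0 := fun k h => by
    -- If `U k` vanished, independence of `V` would kill the formal even part, whose leading
    -- coefficient is 1.
    have h0 : evenPart a (k - s - 1) = 0 := by
      refine linearIndepOn_iff.1 (hstep (k - s - 1)) _
        (Finsupp.supported_mono (stepSet_subset ?_ ?_ ?_) (evenPart_mem a _)) ((hEO _).trans h)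
      · lia
      · lia
      · lia
    have := evenPart_apply_top a (k - s - 1)
    simp [h0] at this
  have hUmem : ∀ k, U k ∈ hyperplaneInter x k :=
    linearCombination_oddPart_mem_inter hV.represents one_ne_zero hEO'
  have hex : ∀ k, ∃ c : ℝ, c • U k = W k := fun k => by
    have h1 := pentagramMap_eq_mk hx (hUne k) (hUmem k)
    obtain ⟨h, e⟩ := hW.represents k
    rw [← e, eq_comm] at h1
    exact (Projectivization.mk_eq_mk_iff' ℝ _ _ _ _).1 h1
  choose c hc using hex
  obtain rfl : (fun j => c j • U j) = W := funext hc
  refine ⟨c, fun k => ?_, fun k => ?_, fun k => ?_⟩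
  · have h1 := hW.monodromy k
    have h2 : U (k + N) = g • U k := by
      simp only [hU]
      rw [show k + N - (s : ℤ) - 1 = k - s - 1 + N by ring,
        linearCombination_oddPart_periodic hper hV.monodromy]
    have h3 : c (k + N) • U (k + N) = c k • U (k + N) := by
      rw [h1, h2, smul_vec_eq, smul_vec_eq, Matrix.mulVec_smul]
    exact smul_left_injective ℝ (hUne _) h3
  · rw [← hW.det_eq_one k, det_frame_smul, det_frame_oddPart hV.det_eq_one hEO']
  · rw [← sub_eq_zero]
    refine linearIndepOn_iff.1 (hstep (k - s)) _ (Submodule.sub_mem _ ?_ ?_) ?_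
    · refine linearCombination_mem_supported (evenPart_mem b k) fun j hj => ?_
      obtain ⟨h1, h2, h3⟩ := hj
      refine Submodule.smul_mem _ _ (Finsupp.supported_mono (stepSet_subset ?_ ?_ ?_)
        (oddPart_mem a _))
      · lia
      · lia
      · lia
    · refine linearCombination_mem_supported (oddPart_mem b k) fun j hj => ?_
      obtain ⟨h1, h2, h3⟩ := hj
      refine Submodule.smul_mem _ _ (Finsupp.supported_mono (stepSet_subset ?_ ?_ ?_)
        (evenPart_mem a _))
      · lia
      · lia
      · lia
    · rw [map_sub, sub_eq_zero]
      simp only [Finsupp.linearCombination_linearCombination, map_smul, hEO]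
      exact recurrence_iff.1 (show Recurrence b fun j => c j • U j from hrecW) k

theorem periodic_of_coprime {c : ℤ → ℝ} {d : ℕ} (hN : N.Coprime d) (h1 : ∀ k, c (k + N) = c k)
    (h2 : ∀ k, c (k + d) = c k) (k : ℤ) : c k = c 0 := by
  have p1 : Function.Periodic c (N : ℤ) := h1
  have p2 : Function.Periodic c (d : ℤ) := h2
  have hb := Nat.gcd_eq_gcd_ab N d
  rw [hN.gcd_eq_one] at hb
  have p : Function.Periodic c 1 := by
    have := (p1.int_mul (N.gcdA d)).add_period (p2.int_mul (N.gcdB d))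
    rw [Nat.cast_one] at hb
    rw [hb, mul_comm (N : ℤ), mul_comm (d : ℤ)]
    exact this
  simpa using p.int_mul_eq k

/-- The ratio `c` of two normalized lifts is `N`-periodic by the monodromy and `(n+1)`-periodic by
the determinants, hence constant by coprimality; a constant cancels from the recurrence. -/
theorem hasInvariants_unique (hN : N.Coprime (2 * s + 2)) {g : SLn s} {x : ℤ → RP s}
    {a b : Coords s} (ha : HasInvariants N g x a) (hb : HasInvariants N g x b) : a = b := by
  obtain ⟨V, hV, hrec⟩ := ha
  obtain ⟨W, hW, hrecW⟩ := hb
  have hne : ∀ k, (frame V k).det ≠ 0 := fun k => by rw [hV.det_eq_one]; exact one_ne_zero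
  have hV0 : ∀ k, V k ≠ 0 := fun k => ne_zero_of_det_frame (hne k)
  have hex : ∀ k, ∃ c : ℝ, c • V k = W k := fun k => by
    obtain ⟨h, e⟩ := hV.represents k
    obtain ⟨h', e'⟩ := hW.represents k
    exact (Projectivization.mk_eq_mk_iff' ℝ _ _ h' h).1 (e'.trans e.symm)
  choose c hc using hex
  obtain rfl : (fun j => c j • V j) = W := funext hc
  have hprod : ∀ k, ∏ i : Fin (2 * s + 2), c (k + (i : ℤ)) = 1 := fun k => by
    have := hW.det_eq_one k
    rwa [det_frame_smul, hV.det_eq_one, mul_one] at this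
  have hc0 : ∀ k, c k ≠ 0 := fun k h => by
    have := hW.represents k
    simp [h] at this
  have hcN : ∀ k, c (k + N) = c k := fun k => by
    have h1 := hW.monodromy k
    have h3 : c (k + N) • V (k + N) = c k • V (k + N) := by
      rw [h1, hV.monodromy, smul_vec_eq, smul_vec_eq, Matrix.mulVec_smul]
    exact smul_left_injective ℝ (hV0 _) h3
  -- The products over the windows at `k` and `k + 1` are both 1 and share all factors but the two
  -- extreme ones.
  have hcd : ∀ k, c (k + (2 * s + 2 : ℕ)) = c k := fun k => by
    have h1 := hprod k
    have h2 := hprod (k + 1)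
    rw [Fin.prod_univ_succ] at h1
    rw [Fin.prod_univ_castSucc] at h2
    have e : ∏ i : Fin (2 * s + 1), c (k + 1 + (i.castSucc : ℤ)) =
        ∏ i : Fin (2 * s + 1), c (k + (i.succ : ℤ)) :=
      Finset.prod_congr rfl fun i _ => by
        congr 1
        simp only [Fin.val_castSucc, Fin.val_succ]
        push_cast
        ring
    rw [e] at h2
    have h3 := h2.trans h1.symm
    rw [mul_comm] at h3
    have h4 := mul_right_cancel₀ (right_ne_zero_of_mul_eq_one h1) h3
    convert h4 using 2
    · simp only [Fin.val_last]
      push_cast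
      ring
    · simp
  have hconst := periodic_of_coprime hN hcN hcd
  funext k
  refine coords_unique hne (k := k) ?_
  have h1 := hrecW k
  simp only [hconst] at h1
  have h2 : c 0 • V (k + (2 * s + 2)) =
      c 0 • ((∑ j : Fin (2 * s + 1), b k j • V (k + ((j : ℤ) + 1))) +
        (-1 : ℝ) ^ (2 * s + 1) • V k) := by
    rw [h1]
    simp only [smul_add, Finset.smul_sum, smul_comm (c 0)]
  have h3 := (hrec k).symm.trans (smul_right_injective _ (hc0 0) h2)
  exact add_right_cancel h3

end Lifts

/-! ### The degenerate case `s = 0`. -/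

section Line

variable {x : ℤ → RP 0}

theorem hyperplane_line (x : ℤ → RP 0) (k : ℤ) : hyperplane x k = (x k).submodule := by
  change ⨆ j : Fin 1, (x (k - 2 * (0 : ℕ) + 2 * (j : ℤ))).submodule = _
  rw [iSup_unique]
  simp

theorem hyperplaneInter_line (x : ℤ → RP 0) (k : ℤ) : hyperplaneInter x k = (x k).submodule := by
  change ⨅ j : Fin 1, hyperplane x (k - (0 : ℕ) + (j : ℤ)) = _
  rw [iInf_unique, hyperplane_line]
  simp

theorem isGeneric_line (x : ℤ → RP 0) : IsGeneric x where
  finrank_hyperplane k := by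
    rw [hyperplane_line, Projectivization.finrank_submodule]
  finrank_inter k := by
    rw [hyperplaneInter_line, Projectivization.finrank_submodule]

theorem pentagramMap_line (hx : IsGeneric x) : pentagramMap x hx = x := by
  funext k
  apply Projectivization.submodule_injective
  rw [pentagramMap, Projectivization.submodule_mk'', hyperplaneInter_line]

end Line

/-! ### The induced map on invariants. -/

section Induced

variable {s N : ℕ}

/-- This carries both claims: `t = 1` gives independence of the chosen polygon, general `t` the
scaling. For `s = 0` uniqueness forces `a = b`. -/
theorem InducedMap.hasInvariants_pentagramMap (hN : N.Coprime (2 * s + 2)) {a b : Coords s}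
    (hab : InducedMap s N a b) {t : ℝ} (ht : t ≠ 0) {g : SLn s} {x : ℤ → RP s}
    (hx : HasInvariants N g x (scaling t a)) :
    ∃ hg : IsGeneric x, HasInvariants N g (pentagramMap x hg) (scaling t b) := by
  obtain ⟨M, y, hy, -, ha, hb⟩ := hab
  rcases Nat.eq_zero_or_pos s with rfl | hs
  · rw [pentagramMap_line] at hb
    obtain rfl := hasInvariants_unique hN ha hb
    exact ⟨isGeneric_line x, by rwa [pentagramMap_line]⟩
  · obtain ⟨c, hc⟩ := exists_intertwines hs ha hb
    exact hasInvariants_pentagramMap_of_intertwines hc ht hx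

theorem HasInvariants.periodic {g : SLn s} {x : ℤ → RP s} {a : Coords s}
    (h : HasInvariants N g x a) (k : ℤ) : a (k + N) = a k := by
  obtain ⟨V, hV, hrec⟩ := h
  exact coords_periodic (fun k => by rw [hV.det_eq_one]; exact one_ne_zero) hV.monodromy hrec k

theorem HasInvariants.isTwisted {g : SLn s} {x : ℤ → RP s} {a : Coords s}
    (h : HasInvariants N g x a) : IsTwisted N g x := by
  obtain ⟨V, hV, -⟩ := h
  intro k
  obtain ⟨h1, e1⟩ := hV.represents k
  obtain ⟨h2, e2⟩ := hV.represents (k + N)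
  rw [← e1, ← e2, Projectivization.smul_mk]
  congr 1
  exact hV.monodromy k

theorem InducedMap.scaling (hN : N.Coprime (2 * s + 2)) {a b : Coords s}
    (hab : InducedMap s N a b) {t : ℝ} (ht : t ≠ 0) :
    InducedMap s N (scaling t a) (scaling t b) := by
  have hper : ∀ k, Pentagram.scaling t a (k + N) = Pentagram.scaling t a k := by
    obtain ⟨M, y, hy, -, ha, hb⟩ := hab
    intro k
    funext j
    simp only [Pentagram.scaling, ha.periodic]
  obtain ⟨g, x, hx⟩ := exists_recurrence hper
  obtain ⟨hg, h⟩ := hab.hasInvariants_pentagramMap hN ht hx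
  exact ⟨g, x, hg, hx.isTwisted, hx, h⟩

end Induced

end Pentagram

/-- On `RP^{2s+1}`, for `N` coprime to `2s+2`: the generalized pentagram map descends to a
well-defined partial map of the projective invariants of twisted `N`-gons, and this map, with its
domain, is invariant under the scaling of the invariants with odd upper index. -/
theorem mainTheorem1 (s N : ℕ) (hN : Nat.Coprime N (2 * s + 2)) :
    (∀ a b : Pentagram.Coords s, Pentagram.InducedMap s N a b →
      ∀ (M : Pentagram.SLn s) (x : ℤ → Pentagram.RP s),
        Pentagram.HasInvariants N M x a →
        ∃ hx : Pentagram.IsGeneric x, ∀ b' : Pentagram.Coords s,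
          Pentagram.HasInvariants N M (Pentagram.pentagramMap x hx) b' ↔ b' = b) ∧
    (∀ t : ℝ, t ≠ 0 → ∀ a b : Pentagram.Coords s,
      Pentagram.InducedMap s N (Pentagram.scaling t a) (Pentagram.scaling t b) ↔
        Pentagram.InducedMap s N a b) := by
  refine ⟨fun a b hab M x hx => ?_, fun t ht a b => ⟨fun h => ?_, fun h => h.scaling hN ht⟩⟩
  · rw [← Pentagram.scaling_one a] at hx
    obtain ⟨hg, h⟩ := hab.hasInvariants_pentagramMap hN one_ne_zero hx
    rw [Pentagram.scaling_one] at h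
    exact ⟨hg, fun b' => ⟨fun h' => Pentagram.hasInvariants_unique hN h' h, fun e => e ▸ h⟩⟩
  -- The converse is the forward direction for `t⁻¹`.
  · have := h.scaling hN (inv_ne_zero ht)
    simpa only [Pentagram.scaling_scaling, inv_mul_cancel₀ ht, Pentagram.scaling_one] using this
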